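/- Let $\omega=(\sqrt5-1)/2$ and, for $\lambda\in\mathbb R$, let $V(n)=\lambda\,\chi_{[1-\omega,1)}(n\omega \bmod 1)$, $n\in\mathbb Z$, be the Fibonacci potential. Let $F_0=F_1=1$, $F_{k+1}=F_k+F_{k-1}$ for $k\ge 1$. For $E\in\mathbb R$ put $$A(n,E)=\begin{pmatrix}E-V(n)&-1\\1&0\end{pmatrix},\qquad M_k(E,\lambda)=A(F_k,E)A(F_k-1,E)\cdots A(1,E),\qquad x_k(E,\lambda)=\operatorname{tr}M_k(E,\lambda),$$ and $\sigma_k=\sigma_k(\lambda)=\{E\in\mathbb R:\ |x_k(E,\lambda)|\le 2\}$. Let $\gamma=\gamma(\lambda)=\dfrac{\log(2\lambda+22)}{\log\omega^{-1}}-1$, and let $|\cdot|$ denote Lebesgue measure. There is an absolute constant $C>0$ such that for every $\lambda>4$ and every integer $k\ge 0$: the set $\sigma_k$ is the union of $F_k$ pairwise disjoint compact intervals, each of which, $I_k$ say, satisfies $$|I_k|\ \ge\ \frac{4}{C(2\lambda+22)^k};$$ moreover, with the same constant $C$, $$|\sigma_k|\ \ge\ \frac4C\,F_k^{-\gamma}.$$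 -/

import Mathlib

open MeasureTheory

noncomputable section

namespace FibHam

/-- The Fibonacci numbers with `F 0 = 1`, `F 1 = 1`, `F (k + 1) = F k + F (k - 1)`. -/
def F (k : ℕ) : ℕ := Nat.fib (k + 1)

/-- The inverse of the golden mean. -/
def ω : ℝ := (Real.sqrt 5 - 1) / 2

/-- The Fibonacci potential `V(n) = lam * χ_[1 - ω, 1) (n ω mod 1)`. -/
def V (lam : ℝ) (n : ℤ) : ℝ :=
  lam * Set.indicator (Set.Ico (1 - ω) 1) (fun _ => (1 : ℝ)) (Int.fract ((n : ℝ) * ω))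

/-- The one-step transfer matrix at site `n` and energy `E`, for the operator
`(H ψ)(n) = ψ(n - 1) + ψ(n + 1) + V(n) ψ(n)`. -/
def A (lam : ℝ) (n : ℤ) (E : ℝ) : Matrix (Fin 2) (Fin 2) ℝ :=
  !![E - V lam n, -1; 1, 0]

/-- The product `A(m + j) * A(m + j - 1) * ⋯ * A(m + 1)` of `j` one-step matrices. -/
def stepProd (lam E : ℝ) (m : ℤ) : ℕ → Matrix (Fin 2) (Fin 2) ℝ
  | 0 => 1
  | j + 1 => A lam (m + (j + 1 : ℕ)) E * stepProd lam E m j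

/-- The transfer matrix `T(n, m; E)`: it is `A(n) * A(n - 1) * ⋯ * A(m + 1)` for `n > m`, the
identity for `n = m`, and the inverse of `T(m, n; E)` for `n < m`. -/
def T (lam : ℝ) (n m : ℤ) (E : ℝ) : Matrix (Fin 2) (Fin 2) ℝ :=
  if m ≤ n then stepProd lam E m (n - m).toNat else (stepProd lam E n (m - n).toNat)⁻¹

/-- The transfer matrix `A(F k) * ⋯ * A(1)` over the sites `1, …, F k`. -/
def M (lam : ℝ) (k : ℕ) (E : ℝ) : Matrix (Fin 2) (Fin 2) ℝ := T lam (F k : ℤ) 0 E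

/-- The trace `x_k(E, lam)`. -/
def x (lam : ℝ) (k : ℕ) (E : ℝ) : ℝ := (M lam k E).trace

/-- The set `σ_k` of the energies `E` with `|x_k(E, lam)| ≤ 2`. -/
def σ (lam : ℝ) (k : ℕ) : Set ℝ := {E : ℝ | |x lam k E| ≤ 2}

/-- The exponent `γ(lam) = log (2 lam + 22) / log (ω⁻¹) - 1`. -/
def γ (lam : ℝ) : ℝ := Real.log (2 * lam + 22) / Real.log ω⁻¹ - 1

end FibHam

end

/-!
Up to an index shift, the traces satisfy `t (n + 3) = t (n + 2) * t (n + 1) - t n`, and the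
Fricke–Vogt polynomial of three consecutive traces is the constant `4 + lam ^ 2`. For `lam > 4` this
forbids three consecutive traces in `[-2, 2]`. The signs of the traces at the ends of a band of
`t n` then force bands of later traces inside it, in numbers obeying the Fibonacci recursion, and
since `t n` is a polynomial of Fibonacci degree it has no further bands. Differentiating the
constant of motion bounds the derivative of `t n` on its bands by `(2 * lam + 22) ^ (n - 2)`, and
the mean value theorem bounds their lengths from below.
-/

noncomputable section

namespace FibHam

open Set Polynomial

/-! ### The trace polynomials -/

section CommRing

variable {R : Type*} [CommRing R]

/-- The Fricke–Vogt polynomial, the conserved quantity of the trace map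
`(x, y, z) ↦ (y, z, y z - x)`. -/
def frickeVogt (x y z : R) : R := x ^ 2 + y ^ 2 + z ^ 2 - x * y * z

theorem frickeVogt_swap (x y z : R) : frickeVogt x z y = frickeVogt x y z := by
  simp only [frickeVogt]; ring

theorem frickeVogt_rotate (x y z : R) : frickeVogt y z x = frickeVogt x y z := by
  simp only [frickeVogt]; ring

theorem frickeVogt_traceMap (x y z : R) :
    frickeVogt y z (z * y - x) = frickeVogt x y z := by
  simp only [frickeVogt]; ring

/-- The trace polynomials of the Fibonacci Hamiltonian in the energy variable. The indexing is
shifted, with `tracePoly lam (k + 1)` standing for the paper's `x_k` when `k ≥ 1`, so that the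
trace recursion starts from the constant `2`. -/
def tracePoly (lam : R) : ℕ → R[X]
  | 0 => 2
  | 1 => X
  | 2 => X - C lam
  | n + 3 => tracePoly lam (n + 2) * tracePoly lam (n + 1) - tracePoly lam n

theorem frickeVogt_tracePoly (lam : R) (n : ℕ) :
    frickeVogt (tracePoly lam n) (tracePoly lam (n + 1)) (tracePoly lam (n + 2)) =
      4 + C lam ^ 2 := by
  induction n with
  | zero => simp only [frickeVogt, tracePoly]; ring
  | succ n ih => rw [tracePoly, frickeVogt_traceMap, ih]

theorem isMonicOfDegree_tracePoly [Nontrivial R] (lam : R) :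
    ∀ n, IsMonicOfDegree (tracePoly lam (n + 1)) (Nat.fib (n + 1))
  | 0 => isMonicOfDegree_X R
  | 1 => isMonicOfDegree_X_sub_one lam
  | 2 => by
    rw [tracePoly]
    exact ((isMonicOfDegree_X_sub_one lam).mul (isMonicOfDegree_X R)).sub
      (by simp [tracePoly])
  | n + 3 => by
    have h : IsMonicOfDegree (tracePoly lam (n + 3) * tracePoly lam (n + 2)) (Nat.fib (n + 4)) := by
      rw [Nat.fib_add_two, add_comm (Nat.fib _)]
      exact (isMonicOfDegree_tracePoly lam (n + 2)).mul (isMonicOfDegree_tracePoly lam (n + 1))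
    refine h.sub ?_
    rw [(isMonicOfDegree_tracePoly lam n).natDegree_eq]
    exact (Nat.fib_mono (by lia)).trans_lt (Nat.fib_lt_fib_succ (n := n + 3) (by lia))

end CommRing

/-- The trace polynomial as a function of the energy. -/
def tr (lam : ℝ) (n : ℕ) (E : ℝ) : ℝ := (tracePoly lam n).eval E

theorem tr_zero (lam E : ℝ) : tr lam 0 E = 2 := by simp [tr, tracePoly]

theorem tr_one (lam E : ℝ) : tr lam 1 E = E := by simp [tr, tracePoly]

theorem tr_two (lam E : ℝ) : tr lam 2 E = E - lam := by simp [tr, tracePoly]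

theorem tr_rec (lam : ℝ) (n : ℕ) (E : ℝ) :
    tr lam (n + 3) E = tr lam (n + 2) E * tr lam (n + 1) E - tr lam n E := by
  simp [tr, tracePoly]

theorem differentiable_tr (lam : ℝ) (n : ℕ) : Differentiable ℝ (tr lam n) :=
  (tracePoly lam n).differentiable

theorem deriv_tr (lam : ℝ) (n : ℕ) (E : ℝ) :
    deriv (tr lam n) E = (derivative (tracePoly lam n)).eval E :=
  (tracePoly lam n).deriv

theorem deriv_tr_zero (lam E : ℝ) : deriv (tr lam 0) E = 0 := by
  simp [deriv_tr, tracePoly]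

theorem deriv_tr_one (lam E : ℝ) : deriv (tr lam 1) E = 1 := by
  simp [deriv_tr, tracePoly]

theorem deriv_tr_two (lam E : ℝ) : deriv (tr lam 2) E = 1 := by
  simp [deriv_tr, tracePoly]

theorem deriv_tr_rec (lam : ℝ) (n : ℕ) (E : ℝ) :
    deriv (tr lam (n + 3)) E = deriv (tr lam (n + 2)) E * tr lam (n + 1) E
      + tr lam (n + 2) E * deriv (tr lam (n + 1)) E - deriv (tr lam n) E := by
  simp [deriv_tr, tr, tracePoly]

theorem frickeVogt_tr (lam : ℝ) (n : ℕ) (E : ℝ) :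
    frickeVogt (tr lam n E) (tr lam (n + 1) E) (tr lam (n + 2) E) = 4 + lam ^ 2 := by
  simpa [frickeVogt, tr] using congrArg (eval E) (frickeVogt_tracePoly lam n)

theorem frickeVogt_deriv_tr (lam : ℝ) (n : ℕ) (E : ℝ) :
    (2 * tr lam n E - tr lam (n + 1) E * tr lam (n + 2) E) * deriv (tr lam n) E
      + (2 * tr lam (n + 1) E - tr lam n E * tr lam (n + 2) E) * deriv (tr lam (n + 1)) E
      + (2 * tr lam (n + 2) E - tr lam n E * tr lam (n + 1) E) * deriv (tr lam (n + 2)) E = 0 := by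
  have h := congrArg (fun p => (derivative p).eval E) (frickeVogt_tracePoly lam n)
  simp only [frickeVogt, derivative_sub, derivative_add, derivative_mul, derivative_pow,
    derivative_C, derivative_ofNat, eval_sub, eval_add, eval_mul, eval_pow, eval_C, eval_zero] at h
  simp only [deriv_tr, tr]
  linear_combination h

/-! ### Bounds on the surface of constant invariant -/

section Surface

variable {lam x y z : ℝ}

theorem sq_le_four (hx : |x| ≤ 2) : x ^ 2 ≤ 4 := by
  simpa [show (2 : ℝ) ^ 2 = 4 by norm_num] using pow_le_pow_left₀ (abs_nonneg x) hx 2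

theorem two_lt_abs_of_frickeVogt (hlam : 4 < lam) (h : frickeVogt x y z = 4 + lam ^ 2)
    (hx : |x| ≤ 2) (hy : |y| ≤ 2) : 2 < |z| := by
  by_contra! hz
  have hxyz : |x * y * z| ≤ 2 * 2 * 2 := by
    rw [abs_mul, abs_mul]; gcongr
  simp only [frickeVogt] at h
  nlinarith [neg_abs_le (x * y * z), sq_le_four hx, sq_le_four hy, sq_le_four hz]

theorem sq_two_mul_sub_mul_of_frickeVogt (h : frickeVogt x y z = 4 + lam ^ 2) :
    (2 * z - x * y) ^ 2 = (2 * lam) ^ 2 + (4 - x ^ 2) * (4 - y ^ 2) := by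
  simp only [frickeVogt] at h; linear_combination 4 * h

theorem abs_le_of_frickeVogt (hlam : 4 < lam) (h : frickeVogt x y z = 4 + lam ^ 2)
    (hx : |x| ≤ 2) (hy : |y| ≤ 2) : |z| ≤ lam + 5 / 2 := by
  have hxy : |x * y| ≤ 2 * 2 := by rw [abs_mul]; gcongr
  have hz : |2 * z - x * y| ≤ 2 * lam + 1 := by
    refine abs_le_of_sq_le_sq ?_ (by linarith)
    rw [sq_two_mul_sub_mul_of_frickeVogt h]
    nlinarith [mul_nonneg (sq_nonneg x) (sub_nonneg.2 (sq_le_four hy)), sq_nonneg y]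
  rw [abs_le] at hxy hz ⊢
  constructor <;> linarith

-- At such a point the partial derivative in the third coordinate dominates the other two.
theorem abs_deriv_le_of_frickeVogt {x' y' z' : ℝ} (hlam : 4 < lam)
    (h : frickeVogt x y z = 4 + lam ^ 2) (hx : |x| ≤ 2) (hy : |y| ≤ 2)
    (h' : (2 * x - y * z) * x' + (2 * y - x * z) * y' + (2 * z - x * y) * z' = 0) :
    |z'| ≤ |x'| + |y'| := by
  have hx2 : 0 ≤ 4 - x ^ 2 := sub_nonneg.2 (sq_le_four hx)
  have hy2 : 0 ≤ 4 - y ^ 2 := sub_nonneg.2 (sq_le_four hy)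
  have hz2 : 4 - z ^ 2 ≤ 0 := by
    nlinarith [two_lt_abs_of_frickeVogt hlam h hx hy, sq_abs z]
  have hdx : |2 * x - y * z| ≤ 2 * lam := by
    refine abs_le_of_sq_le_sq ?_ (by linarith)
    rw [sq_two_mul_sub_mul_of_frickeVogt ((frickeVogt_rotate x y z).trans h)]
    linarith [mul_nonpos_of_nonneg_of_nonpos hy2 hz2]
  have hdy : |2 * y - x * z| ≤ 2 * lam := by
    refine abs_le_of_sq_le_sq ?_ (by linarith)
    rw [sq_two_mul_sub_mul_of_frickeVogt ((frickeVogt_swap x y z).trans h)]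
    linarith [mul_nonpos_of_nonneg_of_nonpos hx2 hz2]
  have hdz : 2 * lam ≤ |2 * z - x * y| := by
    refine (le_abs_self _).trans (sq_le_sq.1 ?_)
    rw [sq_two_mul_sub_mul_of_frickeVogt h]
    linarith [mul_nonneg hx2 hy2]
  have key : 2 * lam * |z'| ≤ 2 * lam * (|x'| + |y'|) := calc
    2 * lam * |z'| ≤ |2 * z - x * y| * |z'| := by gcongr
    _ = |(2 * x - y * z) * x' + (2 * y - x * z) * y'| := by
      rw [← abs_mul, ← abs_neg]; congr 1; linear_combination -h'
    _ ≤ |2 * x - y * z| * |x'| + |2 * y - x * z| * |y'| := by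
      rw [← abs_mul, ← abs_mul]; exact abs_add_le _ _
    _ ≤ 2 * lam * |x'| + 2 * lam * |y'| := by gcongr
    _ = 2 * lam * (|x'| + |y'|) := by ring
  exact le_of_mul_le_mul_left key (by linarith)

end Surface

/-! ### Consecutive traces at a point -/

section Pointwise

variable {lam E : ℝ} {n : ℕ}

theorem two_lt_abs_tr_add_two (hlam : 4 < lam) (h0 : |tr lam n E| ≤ 2)
    (h1 : |tr lam (n + 1) E| ≤ 2) : 2 < |tr lam (n + 2) E| :=
  two_lt_abs_of_frickeVogt hlam (frickeVogt_tr lam n E) h0 h1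

theorem two_lt_abs_tr_succ (hlam : 4 < lam) (h0 : |tr lam n E| ≤ 2)
    (h2 : |tr lam (n + 2) E| ≤ 2) : 2 < |tr lam (n + 1) E| :=
  lt_of_not_ge fun h1 => (two_lt_abs_tr_add_two hlam h0 h1).not_ge h2

theorem abs_tr_mul_sub_le (lam E : ℝ) (n : ℕ) :
    |tr lam (n + 2) E| * |tr lam (n + 1) E| - |tr lam n E| ≤ |tr lam (n + 3) E| := by
  rw [tr_rec, ← abs_mul]; exact abs_sub_abs_le_abs_sub _ _

theorem abs_tr_le_of_two_lt (h1 : 2 < |tr lam (n + 1) E|)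
    (h2 : 2 < |tr lam (n + 2) E|) : |tr lam n E| ≤ |tr lam (n + 2) E| := by
  induction n with
  | zero => rw [tr_zero, abs_two]; exact h2.le
  | succ n ih =>
    have h0 : |tr lam n E| ≤ |tr lam (n + 2) E| ∨ |tr lam (n + 1) E| ≤ 2 :=
      (lt_or_ge 2 |tr lam (n + 1) E|).imp_left fun h => ih h h1
    rcases h0 with h0 | h0
    · nlinarith [abs_tr_mul_sub_le lam E n]
    · exact h0.trans h2.le

theorem abs_tr_succ_le_two_or (h : |tr lam (n + 2) E| ≤ 2) :
    |tr lam (n + 1) E| ≤ 2 ∨ |tr lam n E| ≤ 2 := by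
  cases n with
  | zero => right; rw [tr_zero, abs_two]
  | succ n =>
    by_contra! hc
    obtain ⟨h2, h1⟩ := hc
    nlinarith [abs_tr_le_of_two_lt h1 h2, abs_tr_mul_sub_le lam E n]

theorem abs_tr_succ_le (hlam : 4 < lam) (h0 : |tr lam n E| ≤ 2)
    (h2 : |tr lam (n + 2) E| ≤ 2) : |tr lam (n + 1) E| ≤ lam + 5 / 2 :=
  abs_le_of_frickeVogt hlam ((frickeVogt_swap _ _ _).trans (frickeVogt_tr lam n E)) h0 h2

theorem abs_deriv_tr_succ_le (hlam : 4 < lam) (h0 : |tr lam n E| ≤ 2)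
    (h2 : |tr lam (n + 2) E| ≤ 2) :
    |deriv (tr lam (n + 1)) E| ≤ |deriv (tr lam n) E| + |deriv (tr lam (n + 2)) E| :=
  abs_deriv_le_of_frickeVogt hlam ((frickeVogt_swap _ _ _).trans (frickeVogt_tr lam n E)) h0 h2
    (by linear_combination frickeVogt_deriv_tr lam n E)

theorem abs_deriv_tr_add_two_le (hlam : 4 < lam) (h0 : |tr lam n E| ≤ 2)
    (h1 : |tr lam (n + 1) E| ≤ 2) :
    |deriv (tr lam (n + 2)) E| ≤ |deriv (tr lam n) E| + |deriv (tr lam (n + 1)) E| :=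
  abs_deriv_le_of_frickeVogt hlam (frickeVogt_tr lam n E) h0 h1 (frickeVogt_deriv_tr lam n E)

theorem abs_deriv_tr_rec_le (lam : ℝ) (n : ℕ) (E : ℝ) :
    |deriv (tr lam (n + 3)) E| ≤ |deriv (tr lam (n + 2)) E| * |tr lam (n + 1) E|
      + |tr lam (n + 2) E| * |deriv (tr lam (n + 1)) E| + |deriv (tr lam n) E| := by
  rw [deriv_tr_rec, ← abs_mul, ← abs_mul]
  exact (abs_sub _ _).trans (by gcongr; exact abs_add_le _ _)

theorem abs_deriv_tr_le_of_succ (hlam : 4 < lam) (h0 : |tr lam n E| ≤ 2)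
    (h2 : |tr lam (n + 2) E| ≤ 2) :
    |deriv (tr lam (n + 3)) E| ≤
      (lam + 9 / 2) * |deriv (tr lam (n + 2)) E| + 3 * |deriv (tr lam n) E| := calc
  _ ≤ |deriv (tr lam (n + 2)) E| * |tr lam (n + 1) E|
      + |tr lam (n + 2) E| * |deriv (tr lam (n + 1)) E| + |deriv (tr lam n) E| :=
    abs_deriv_tr_rec_le lam n E
  _ ≤ |deriv (tr lam (n + 2)) E| * (lam + 5 / 2)
      + 2 * (|deriv (tr lam n) E| + |deriv (tr lam (n + 2)) E|) + |deriv (tr lam n) E| := by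
    gcongr
    · exact abs_tr_succ_le hlam h0 h2
    · exact abs_deriv_tr_succ_le hlam h0 h2
  _ = _ := by ring

theorem abs_deriv_tr_le_of_add_two (hlam : 4 < lam) (h0 : |tr lam n E| ≤ 2)
    (h1 : |tr lam (n + 1) E| ≤ 2) (h3 : |tr lam (n + 3) E| ≤ 2) :
    |deriv (tr lam (n + 3)) E| ≤
      (lam + 9 / 2) * |deriv (tr lam (n + 1)) E| + 3 * |deriv (tr lam n) E| := calc
  _ ≤ |deriv (tr lam (n + 2)) E| * |tr lam (n + 1) E|
      + |tr lam (n + 2) E| * |deriv (tr lam (n + 1)) E| + |deriv (tr lam n) E| :=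
    abs_deriv_tr_rec_le lam n E
  _ ≤ (|deriv (tr lam n) E| + |deriv (tr lam (n + 1)) E|) * 2
      + (lam + 5 / 2) * |deriv (tr lam (n + 1)) E| + |deriv (tr lam n) E| := by
    gcongr
    · exact abs_deriv_tr_add_two_le hlam h0 h1
    · exact abs_tr_succ_le hlam h1 h3
  _ = _ := by ring

theorem abs_deriv_tr_le_of_add_two_of_add_two (hlam : 4 < lam) (h0 : |tr lam n E| ≤ 2)
    (h2 : |tr lam (n + 2) E| ≤ 2) (h4 : |tr lam (n + 4) E| ≤ 2) :
    |deriv (tr lam (n + 4)) E| ≤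
      (3 * lam + 25 / 2) * |deriv (tr lam (n + 2)) E| + 7 * |deriv (tr lam n) E| := calc
  _ ≤ |deriv (tr lam (n + 3)) E| * |tr lam (n + 2) E|
      + |tr lam (n + 3) E| * |deriv (tr lam (n + 2)) E| + |deriv (tr lam (n + 1)) E| :=
    abs_deriv_tr_rec_le lam (n + 1) E
  _ ≤ ((lam + 9 / 2) * |deriv (tr lam (n + 2)) E| + 3 * |deriv (tr lam n) E|) * 2
      + (lam + 5 / 2) * |deriv (tr lam (n + 2)) E|
      + (|deriv (tr lam n) E| + |deriv (tr lam (n + 2)) E|) := by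
    gcongr
    · exact abs_deriv_tr_le_of_succ hlam h0 h2
    · exact abs_tr_succ_le (n := n + 2) hlam h2 h4
    · exact abs_deriv_tr_succ_le hlam h0 h2
  _ = _ := by ring

end Pointwise

theorem mul_add_mul_le_pow {S a b u v : ℝ} {p q m r : ℕ} (hS : 1 ≤ S) (ha : 0 ≤ a) (hb : 0 ≤ b)
    (hab : a + b ≤ S ^ r) (hp : p ≤ m) (hq : q ≤ m) (hu : u ≤ S ^ p) (hv : v ≤ S ^ q) :
    a * u + b * v ≤ S ^ (r + m) := calc
  a * u + b * v ≤ a * S ^ m + b * S ^ m := by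
    gcongr
    · exact hu.trans (pow_le_pow_right₀ hS hp)
    · exact hv.trans (pow_le_pow_right₀ hS hq)
  _ = (a + b) * S ^ m := by ring
  _ ≤ S ^ r * S ^ m := by gcongr
  _ = S ^ (r + m) := (pow_add S r m).symm

-- Going back from `E`, small traces occur with gaps at most two and never three in a row, which
-- leaves the three patterns of the preceding lemmas.
theorem abs_deriv_tr_le {lam : ℝ} (hlam : 4 < lam) (E : ℝ) :
    ∀ n, |tr lam n E| ≤ 2 → |deriv (tr lam n) E| ≤ (2 * lam + 22) ^ (n - 2)
  | 0, _ => by simp [deriv_tr_zero]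
  | 1, _ => by simp [deriv_tr_one]
  | 2, _ => by simp [deriv_tr_two]
  | n + 3, h3 => by
    have hS : 1 ≤ 2 * lam + 22 := by linarith
    have ih := fun m (_ : m < n + 3) => abs_deriv_tr_le hlam E m
    rw [show n + 3 - 2 = 1 + n by lia]
    rcases abs_tr_succ_le_two_or (n := n + 1) h3 with h2 | h1
    · have h1 : 2 < |tr lam (n + 1) E| :=
        lt_of_not_ge fun h1 => (two_lt_abs_tr_succ (n := n + 1) hlam h1 h3).not_ge h2
      have h0 : |tr lam n E| ≤ 2 := (abs_tr_succ_le_two_or h2).resolve_left h1.not_ge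
      exact (abs_deriv_tr_le_of_succ hlam h0 h2).trans <|
        mul_add_mul_le_pow hS (by linarith) (by norm_num) (by linarith) (by lia) (by lia)
          (ih _ (by lia) h2) (ih _ (by lia) h0)
    · rcases le_or_gt |tr lam n E| 2 with h0 | h0
      · exact (abs_deriv_tr_le_of_add_two hlam h0 h1 h3).trans <|
          mul_add_mul_le_pow hS (by linarith) (by norm_num) (by linarith) (by lia) (by lia)
            (ih _ (by lia) h1) (ih _ (by lia) h0)
      · obtain _ | n := n
        · simp [tr_zero] at h0
        have hn : |tr lam n E| ≤ 2 := (abs_tr_succ_le_two_or h1).resolve_left h0.not_ge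
        rw [show 1 + (n + 1) = 2 + n by lia]
        exact (abs_deriv_tr_le_of_add_two_of_add_two hlam hn h1 h3).trans <|
          mul_add_mul_le_pow hS (by linarith) (by norm_num) (by nlinarith) (by lia) (by lia)
            (ih _ (by lia) h1) (ih _ (by lia) hn)

/-! ### Bands of a continuous function -/

theorem exists_Icc_mapsTo_Icc {f : ℝ → ℝ} {a b p q : ℝ} (hf : ContinuousOn f (Icc a b))
    (hab : a ≤ b) (ha : f a < p) (hpq : p < q) (hb : q < f b) :
    ∃ c d, c < d ∧ Icc c d ⊆ Ioo a b ∧ f c = p ∧ f d = q ∧ MapsTo f (Icc c d) (Icc p q) := by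
  have hcompact {c : ℝ} (hc : a ≤ c) {s : Set ℝ} (hs : IsClosed s) :
      IsCompact (Icc c b ∩ f ⁻¹' s) :=
    isCompact_Icc.of_isClosed_subset
      ((hf.mono (Icc_subset_Icc_left hc)).preimage_isClosed_of_isClosed isClosed_Icc hs)
      inter_subset_left
  obtain ⟨c, ⟨hc, hfc⟩, hcmax⟩ :=
    (hcompact le_rfl isClosed_Iic).exists_isGreatest ⟨a, left_mem_Icc.2 hab, ha.le⟩
  obtain ⟨c', hc', hfc'⟩ : p ∈ f '' Icc c b :=
    intermediate_value_Icc hc.2 (hf.mono (Icc_subset_Icc_left hc.1)) ⟨hfc, (hpq.trans hb).le⟩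
  obtain rfl : c = c' := hc'.1.antisymm (hcmax ⟨⟨hc.1.trans hc'.1, hc'.2⟩, hfc'.le⟩)
  obtain ⟨d, ⟨hd, hfd⟩, hdmin⟩ :=
    (hcompact hc.1 isClosed_Ici).exists_isLeast ⟨b, right_mem_Icc.2 hc.2, hb.le⟩
  obtain ⟨d', hd', hfd'⟩ : q ∈ f '' Icc c d :=
    intermediate_value_Icc hd.1 (hf.mono (Icc_subset_Icc hc.1 hd.2)) ⟨hfc'.trans_le hpq.le, hfd⟩
  obtain rfl : d = d' := (hdmin ⟨⟨hd'.1, hd'.2.trans hd.2⟩, hfd'.ge⟩).antisymm hd'.2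
  have hac : a < c := hc.1.lt_of_ne (by rintro rfl; exact ha.ne hfc')
  have hdb : d < b := hd.2.lt_of_ne (by rintro rfl; exact hb.ne' hfd')
  have hcd : c < d := hd.1.lt_of_ne (by rintro rfl; exact hpq.ne (hfc'.symm.trans hfd'))
  refine ⟨c, d, hcd, Icc_subset_Ioo hac hdb, hfc', hfd', fun x hx => ⟨?_, ?_⟩⟩
  · rcases hx.1.eq_or_lt with rfl | hlt
    · exact hfc'.ge
    · exact le_of_not_gt fun h => hlt.not_ge (hcmax ⟨⟨hc.1.trans hx.1, hx.2.trans hd.2⟩, h.le⟩)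
  · rcases hx.2.eq_or_lt with rfl | hlt
    · exact hfd'.le
    · exact le_of_not_gt fun h => hlt.not_ge (hdmin ⟨⟨hx.1, hx.2.trans hd.2⟩, h.le⟩)

/-- The interval `[a, b]` is a band of `f`: there `f` takes values in `[-2, 2]`, and it runs from
one end of `[-2, 2]` to the other. -/
structure IsBand (f : ℝ → ℝ) (a b : ℝ) : Prop where
  lt : a < b
  abs_le_two : ∀ x ∈ Icc a b, |f x| ≤ 2
  endpoints : f a = -2 ∧ f b = 2 ∨ f a = 2 ∧ f b = -2

namespace IsBand

variable {f : ℝ → ℝ} {a b : ℝ}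

theorem abs_left (h : IsBand f a b) : |f a| = 2 := by
  rcases h.endpoints with ⟨ha, -⟩ | ⟨ha, -⟩ <;> simp [ha]

theorem abs_right (h : IsBand f a b) : |f b| = 2 := by
  rcases h.endpoints with ⟨-, hb⟩ | ⟨-, hb⟩ <;> simp [hb]

theorem mul_neg (h : IsBand f a b) : f a * f b < 0 := by
  rcases h.endpoints with ⟨ha, hb⟩ | ⟨ha, hb⟩ <;> norm_num [ha, hb]

theorem neg (h : IsBand f a b) : IsBand (-f) a b :=
  ⟨h.lt, fun x hx => by simpa using h.abs_le_two x hx,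
    by simpa [neg_eq_iff_eq_neg] using h.endpoints.symm⟩

theorem exists_eq (h : IsBand f a b) (hf : ContinuousOn f (Icc a b)) {c : ℝ} (hc : |c| ≤ 2) :
    ∃ x ∈ Icc a b, f x = c := by
  rcases h.endpoints with ⟨ha, hb⟩ | ⟨ha, hb⟩
  · exact intermediate_value_Icc h.lt.le hf (by rw [ha, hb]; exact abs_le.1 hc)
  · exact intermediate_value_Icc' h.lt.le hf (by rw [ha, hb]; exact abs_le.1 hc)

theorem four_le_mul_length (h : IsBand f a b) {K : ℝ} (hf : ∀ x ∈ Icc a b, DifferentiableAt ℝ f x)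
    (hK : ∀ x ∈ Icc a b, |deriv f x| ≤ K) : 4 ≤ K * (b - a) := by
  have hmvt := (convex_Icc a b).norm_image_sub_le_of_norm_deriv_le hf hK
    (left_mem_Icc.2 h.lt.le) (right_mem_Icc.2 h.lt.le)
  rw [Real.norm_eq_abs, Real.norm_of_nonneg (sub_nonneg.2 h.lt.le)] at hmvt
  refine le_trans ?_ hmvt
  rcases h.endpoints with ⟨ha, hb⟩ | ⟨ha, hb⟩ <;> norm_num [ha, hb]

end IsBand

theorem exists_isBand {f : ℝ → ℝ} {a b : ℝ} (hf : ContinuousOn f (Icc a b)) (hab : a ≤ b)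
    (ha : 2 < |f a|) (hb : 2 < |f b|) (hs : f a * f b < 0) :
    ∃ c d, Icc c d ⊆ Ioo a b ∧ IsBand f c d := by
  wlog hneg : f a < 0 generalizing f
  · obtain ⟨c, d, hsub, hcd⟩ := this hf.neg (by simpa) (by simpa) (by simpa) (by
      have := abs_pos.1 (two_pos.trans ha)
      simpa using (not_lt.1 hneg).lt_of_ne' this)
    exact ⟨c, d, hsub, by simpa using hcd.neg⟩
  have hpos : 0 < f b := pos_of_mul_neg_right hs hneg.le
  rw [abs_of_neg hneg, lt_neg] at ha
  rw [abs_of_pos hpos] at hb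
  obtain ⟨c, d, hcd, hsub, hc, hd, hmaps⟩ :=
    exists_Icc_mapsTo_Icc hf hab ha (by norm_num) hb
  exact ⟨c, d, hsub, hcd, fun x hx => abs_le.2 (hmaps hx), Or.inl ⟨hc, hd⟩⟩

theorem mul_neg_of_mul_pos {s t p q : ℝ} (hs : 0 < s * p) (ht : 0 < t * q) (hpq : p * q < 0) :
    s * t < 0 := by
  have : (s * t) * (p * q) = (s * p) * (t * q) := by ring
  exact neg_of_mul_pos_left (this ▸ mul_pos hs ht) hpq.le

theorem sub_mul_self_pos_of_abs_lt {u p : ℝ} (h : |u| < |p|) : 0 < (p - u) * p := by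
  have hpos : 0 < (|p| - |u|) * |p| := mul_pos (sub_pos.2 h) ((abs_nonneg u).trans_lt h)
  rw [sub_mul, abs_mul_abs_self, ← abs_mul] at hpos
  linarith [le_abs_self (u * p)]

theorem mul_pos_of_forall_ne_zero {X : Type*} [TopologicalSpace X] {s : Set X} {f : X → ℝ}
    (hs : IsPreconnected s) (hf : ContinuousOn f s) (h0 : ∀ x ∈ s, f x ≠ 0) {a b : X} (ha : a ∈ s)
    (hb : b ∈ s) : 0 < f a * f b := by
  by_contra! hle
  obtain ⟨x, hx, hfx⟩ : 0 ∈ f '' s := by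
    rcases mul_nonpos_iff.1 hle with ⟨ha0, hb0⟩ | ⟨ha0, hb0⟩
    · exact hs.intermediate_value hb ha hf ⟨hb0, ha0⟩
    · exact hs.intermediate_value ha hb hf ⟨ha0, hb0⟩
  exact h0 x hx hfx

theorem IsBand.exists_isBand_mul_sub {w y u : ℝ → ℝ} {a b : ℝ} (hw : IsBand w a b)
    (hy : ContinuousOn y (Icc a b)) (hz : ContinuousOn (fun x => y x * w x - u x) (Icc a b))
    (hy2 : ∀ x ∈ Icc a b, 2 < |y x|) (hu2 : ∀ x ∈ Icc a b, |u x| ≤ 2) :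
    ∃ c d, Icc c d ⊆ Ioo a b ∧ IsBand (fun x => y x * w x - u x) c d := by
  have ha := left_mem_Icc.2 hw.lt.le
  have hb := right_mem_Icc.2 hw.lt.le
  have hedge {x : ℝ} (hx : x ∈ Icc a b) (hwx : |w x| = 2) :
      2 < |y x * w x - u x| ∧ 0 < (y x * w x - u x) * (y x * w x) := by
    have hyw : 4 < |y x * w x| := by rw [abs_mul, hwx]; linarith [hy2 x hx]
    exact ⟨by linarith [abs_sub_abs_le_abs_sub (y x * w x) (u x), hu2 x hx],
      sub_mul_self_pos_of_abs_lt (by linarith [hu2 x hx])⟩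
  have hyab : 0 < y a * y b :=
    mul_pos_of_forall_ne_zero isPreconnected_Icc hy
      (fun x hx => abs_pos.1 (two_pos.trans (hy2 x hx))) ha hb
  obtain ⟨hza, hsa⟩ := hedge ha hw.abs_left
  obtain ⟨hzb, hsb⟩ := hedge hb hw.abs_right
  refine exists_isBand hz hw.lt.le hza hzb (mul_neg_of_mul_pos hsa hsb ?_)
  rw [mul_mul_mul_comm]
  exact mul_neg_of_pos_of_neg hyab hw.mul_neg

/-! ### Counting disjoint bands -/

/-- A finite family of pairwise disjoint bands of `f` inside `s`, each band `[a, b]` being encoded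
by the pair `(a, b)`. -/
structure IsBandFamily (f : ℝ → ℝ) (s : Set ℝ) (S : Finset (ℝ × ℝ)) : Prop where
  isBand : ∀ p ∈ S, IsBand f p.1 p.2
  subset : ∀ p ∈ S, Icc p.1 p.2 ⊆ s
  pairwiseDisjoint : (S : Set (ℝ × ℝ)).PairwiseDisjoint fun p => Icc p.1 p.2

/-- The function `f` has `N` pairwise disjoint bands inside `s`; it may have more. -/
def HasBands (f : ℝ → ℝ) (s : Set ℝ) (N : ℕ) : Prop :=
  ∃ S, IsBandFamily f s S ∧ S.card = N

theorem IsBand.hasBands {f : ℝ → ℝ} {a b : ℝ} (h : IsBand f a b) {s : Set ℝ} (hs : Icc a b ⊆ s) :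
    HasBands f s 1 :=
  ⟨{(a, b)}, ⟨by simpa, by simpa, by simp⟩, rfl⟩

namespace HasBands

variable {f g : ℝ → ℝ} {s t : Set ℝ} {N M : ℕ}

theorem mono (h : HasBands f s N) (hst : s ⊆ t) : HasBands f t N :=
  let ⟨S, hS, hcard⟩ := h
  ⟨S, ⟨hS.isBand, fun p hp => (hS.subset p hp).trans hst, hS.pairwiseDisjoint⟩, hcard⟩

theorem inter_setOf_abs_le_two (h : HasBands f s N) : HasBands f (s ∩ {x | |f x| ≤ 2}) N :=
  let ⟨S, hS, hcard⟩ := h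
  ⟨S, ⟨hS.isBand, fun p hp => subset_inter (hS.subset p hp) (hS.isBand p hp).abs_le_two,
    hS.pairwiseDisjoint⟩, hcard⟩

theorem biUnion {ι : Type*} {I : Finset ι} {s : ι → Set ℝ} {N : ι → ℕ}
    (h : ∀ i ∈ I, HasBands f (s i) (N i)) (hd : (I : Set ι).PairwiseDisjoint s) :
    HasBands f (⋃ i ∈ I, s i) (∑ i ∈ I, N i) := by
  classical
  choose! S hS hcard using h
  refine ⟨I.biUnion S, ⟨fun p hp => ?_, fun p hp => ?_, ?_⟩, ?_⟩
  · obtain ⟨i, hi, hp⟩ := Finset.mem_biUnion.1 hp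
    exact (hS i hi).isBand p hp
  · obtain ⟨i, hi, hp⟩ := Finset.mem_biUnion.1 hp
    exact ((hS i hi).subset p hp).trans (subset_biUnion_of_mem (u := s) hi)
  · rw [Finset.coe_biUnion]
    refine Set.PairwiseDisjoint.biUnion (fun i hi j hj hij => ?_)
      fun i hi => (hS i hi).pairwiseDisjoint
    exact (hd hi hj hij).mono (iSup₂_le (hS i hi).subset) (iSup₂_le (hS j hj).subset)
  · rw [Finset.card_biUnion, Finset.sum_congr rfl hcard]
    refine fun i hi j hj hij => Finset.disjoint_left.2 fun p hp hp' => ?_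
    have hmem : p.1 ∈ Icc p.1 p.2 := left_mem_Icc.2 ((hS i hi).isBand p hp).lt.le
    exact (hd hi hj hij).le_bot ⟨(hS i hi).subset p hp hmem, (hS j hj).subset p hp' hmem⟩

theorem union (hs : HasBands f s N) (ht : HasBands f t M) (hst : Disjoint s t) :
    HasBands f (s ∪ t) (N + M) := by
  have h := biUnion (f := f) (I := .univ) (s := fun i => cond i s t) (N := fun i => cond i N M)
    (by simp [hs, ht]) ((pairwise_disjoint_on_bool.2 hst).set_pairwise _)
  simpa [union_eq_iUnion] using h

theorem refine (h : HasBands f s N)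
    (hg : ∀ a b, IsBand f a b → Icc a b ⊆ s → HasBands g (Icc a b) M) :
    HasBands g (s ∩ {x | |f x| ≤ 2}) (N * M) := by
  obtain ⟨S, hS, rfl⟩ := h
  have h := biUnion (fun p hp => hg p.1 p.2 (hS.isBand p hp) (hS.subset p hp)) hS.pairwiseDisjoint
  rw [Finset.sum_const, smul_eq_mul] at h
  exact h.mono <| iUnion₂_subset fun p hp =>
    subset_inter (hS.subset p hp) (hS.isBand p hp).abs_le_two

end HasBands

-- Each band contains a solution of `p = c` for every `c ∈ [-2, 2]`; a point outside the bands with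
-- `|p| ≤ 2` would give one solution too many.
theorem IsBandFamily.setOf_abs_eval_le_two_eq {p : ℝ[X]} {s : Set ℝ} {S : Finset (ℝ × ℝ)}
    (hS : IsBandFamily (fun x => p.eval x) s S) (hcard : S.card = p.natDegree)
    (hdeg : 0 < p.natDegree) : {x | |p.eval x| ≤ 2} = ⋃ q ∈ S, Icc q.1 q.2 := by
  classical
  refine Subset.antisymm (fun x hx => ?_) (iUnion₂_subset fun q hq => (hS.isBand q hq).abs_le_two)
  by_contra hout
  simp only [mem_iUnion, exists_prop, not_exists, not_and] at hout
  have hsol : ∀ q ∈ S, ∃ r ∈ Icc q.1 q.2, p.eval r = p.eval x :=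
    fun q hq => (hS.isBand q hq).exists_eq p.continuousOn hx
  choose! r hr hrx using hsol
  have hinj : Set.InjOn r S := fun q hq q' hq' h =>
    hS.pairwiseDisjoint.elim_set hq hq' (r q) (hr q hq) (h ▸ hr q' hq')
  have hx_notMem : x ∉ S.image r := fun hmem => by
    obtain ⟨q, hq, rfl⟩ := Finset.mem_image.1 hmem
    exact hout q hq (hr q hq)
  have hconst : p = C (p.eval x) := by
    refine eq_of_natDegree_lt_card_of_eval_eq' p _ (insert x (S.image r)) ?_ ?_
    · simp only [Finset.forall_mem_insert, Finset.forall_mem_image, eval_C]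
      exact ⟨trivial, hrx⟩
    · rw [Finset.card_insert_of_notMem hx_notMem, Finset.card_image_of_injOn hinj, hcard]
      simp
  rw [hconst, natDegree_C] at hdeg
  exact hdeg.false

/-! ### Nested bands of the traces -/

/-- The energies at which the `n`-th trace polynomial takes values in `[-2, 2]`. -/
def bandSet (lam : ℝ) (n : ℕ) : Set ℝ := {E | |tr lam n E| ≤ 2}

section Nested

variable {lam : ℝ} {n : ℕ}

theorem bandSet_zero (lam : ℝ) : bandSet lam 0 = univ := by
  simp [bandSet, tr_zero]

theorem disjoint_bandSet_inter (hlam : 4 < lam) (n : ℕ) :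
    Disjoint (bandSet lam (n + 1) ∩ bandSet lam (n + 2)) (bandSet lam n) :=
  disjoint_left.2 fun _ h h0 => (two_lt_abs_tr_add_two hlam h0 h.1).not_ge h.2

theorem exists_isBand_tr_succ (hlam : 4 < lam) {a b : ℝ} (h : IsBand (tr lam (n + 2)) a b)
    (hsub : Icc a b ⊆ bandSet lam n) :
    ∃ c d, Icc c d ⊆ Ioo a b ∧ IsBand (tr lam (n + 3)) c d := by
  have hrec : tr lam (n + 3) = fun E => tr lam (n + 1) E * tr lam (n + 2) E - tr lam n E := by
    funext E; rw [tr_rec, mul_comm (tr lam (n + 1) E)]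
  rw [hrec]
  exact h.exists_isBand_mul_sub (differentiable_tr lam _).continuous.continuousOn
    (hrec ▸ (differentiable_tr lam _).continuous.continuousOn)
    (fun E hE => two_lt_abs_tr_succ hlam (hsub hE) (h.abs_le_two E hE)) hsub

theorem exists_isBand_tr_add_two (hlam : 4 < lam) {a b : ℝ} (h : IsBand (tr lam (n + 1)) a b)
    (hsub : Icc a b ⊆ bandSet lam n) :
    ∃ c d, Icc c d ⊆ Ioo a b ∧ IsBand (tr lam (n + 3)) c d := by
  have hrec : tr lam (n + 3) = fun E => tr lam (n + 2) E * tr lam (n + 1) E - tr lam n E :=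
    funext (tr_rec lam n)
  rw [hrec]
  exact h.exists_isBand_mul_sub (differentiable_tr lam _).continuous.continuousOn
    (hrec ▸ (differentiable_tr lam _).continuous.continuousOn)
    (fun E hE => two_lt_abs_tr_add_two hlam (hsub hE) (h.abs_le_two E hE)) hsub

theorem tr_add_three_mul_tr_neg (hlam : 4 < lam) {E : ℝ} (h1 : |tr lam (n + 1) E| ≤ 2)
    (h2 : |tr lam (n + 2) E| ≤ 2) : tr lam (n + 3) E * tr lam n E < 0 := by
  have hvieta : tr lam (n + 3) E * tr lam n E =
      tr lam (n + 1) E ^ 2 + tr lam (n + 2) E ^ 2 - 4 - lam ^ 2 := by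
    have h := frickeVogt_tr lam n E
    simp only [frickeVogt] at h
    rw [tr_rec]; linear_combination -h
  nlinarith [sq_le_four h1, sq_le_four h2]

theorem tr_add_four_mul_tr_succ_pos (hlam : 4 < lam) {E : ℝ} (h0 : |tr lam n E| ≤ 2)
    (h2 : |tr lam (n + 2) E| = 2) :
    2 < |tr lam (n + 4) E| ∧ 0 < tr lam (n + 4) E * tr lam (n + 1) E := by
  have h1 : 2 < |tr lam (n + 1) E| := two_lt_abs_tr_succ hlam h0 h2.le
  have hsq : tr lam (n + 2) E ^ 2 = 4 := by rw [← sq_abs, h2]; norm_num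
  have heq : tr lam (n + 4) E = 3 * tr lam (n + 1) E - tr lam (n + 2) E * tr lam n E := by
    rw [tr_rec lam (n + 1), tr_rec lam n]; linear_combination tr lam (n + 1) E * hsq
  have hle : |tr lam (n + 2) E * tr lam n E| ≤ 4 := by rw [abs_mul, h2]; linarith
  have hlt : 6 < |3 * tr lam (n + 1) E| := by
    rw [abs_mul, abs_of_pos three_pos]; linarith
  have hpos := sub_mul_self_pos_of_abs_lt (hle.trans_lt (by linarith))
  rw [heq]
  refine ⟨?_, by linarith⟩
  linarith [abs_sub_abs_le_abs_sub (3 * tr lam (n + 1) E) (tr lam (n + 2) E * tr lam n E)]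

-- `t (n + 4)` and `t (n + 1)` have equal signs at the ends of the band, but opposite signs at the
-- ends of the band of `t (n + 3)` inside it.
theorem hasBands_two_tr_add_two (hlam : 4 < lam) {a b : ℝ} (h : IsBand (tr lam (n + 2)) a b)
    (hsub : Icc a b ⊆ bandSet lam n) : HasBands (tr lam (n + 4)) (Icc a b) 2 := by
  obtain ⟨c, d, hcdsub, hcd⟩ := exists_isBand_tr_succ hlam h hsub
  obtain ⟨hac, hdb⟩ := (Icc_subset_Ioo_iff hcd.lt.le).1 hcdsub
  have hsign {E E' : ℝ} (hE : E ∈ Icc a b) (hE' : E' ∈ Icc a b) :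
      0 < tr lam (n + 1) E * tr lam (n + 1) E' :=
    mul_pos_of_forall_ne_zero isPreconnected_Icc (differentiable_tr lam _).continuous.continuousOn
      (fun x hx => abs_pos.1 (two_pos.trans (two_lt_abs_tr_succ hlam (hsub hx)
        (h.abs_le_two x hx)))) hE hE'
  have hopposite {E E' : ℝ} (hE : E ∈ Icc a b) (hE2 : |tr lam (n + 2) E| = 2)
      (hE' : E' ∈ Icc c d) : 2 < |tr lam (n + 4) E| ∧ 2 < |tr lam (n + 4) E'| ∧
        tr lam (n + 4) E * tr lam (n + 4) E' < 0 := by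
    have hE'ab : E' ∈ Icc a b := Ioo_subset_Icc_self (hcdsub hE')
    have hE'2 := h.abs_le_two E' hE'ab
    have hE'3 := hcd.abs_le_two E' hE'
    obtain ⟨htwo, hpos⟩ := tr_add_four_mul_tr_succ_pos hlam (hsub hE) hE2
    have hneg := tr_add_three_mul_tr_neg (n := n + 1) hlam hE'2 hE'3
    refine ⟨htwo, two_lt_abs_tr_add_two (n := n + 2) hlam hE'2 hE'3,
      mul_neg_of_mul_pos (q := -tr lam (n + 1) E') hpos ?_ ?_⟩
    · linarith
    · linarith [hsign hE hE'ab]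
  obtain ⟨ha, hc, hneg⟩ :=
    hopposite (left_mem_Icc.2 h.lt.le) h.abs_left (left_mem_Icc.2 hcd.lt.le)
  obtain ⟨hb, hd, hneg'⟩ :=
    hopposite (right_mem_Icc.2 h.lt.le) h.abs_right (right_mem_Icc.2 hcd.lt.le)
  have hcont := (differentiable_tr lam (n + 4)).continuous
  obtain ⟨a₁, b₁, hsub₁, hband₁⟩ :=
    exists_isBand hcont.continuousOn hac.le ha hc hneg
  obtain ⟨a₂, b₂, hsub₂, hband₂⟩ :=
    exists_isBand hcont.continuousOn hdb.le hd hb (by rwa [mul_comm])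
  refine ((hband₁.hasBands hsub₁).union (hband₂.hasBands hsub₂) ?_).mono (union_subset ?_ ?_)
  · exact disjoint_left.2 fun x hx hx' => (hx.2.trans hcd.lt).not_gt hx'.1
  · exact Ioo_subset_Icc_self.trans (Icc_subset_Icc_right (hcd.lt.le.trans hdb.le))
  · exact Ioo_subset_Icc_self.trans (Icc_subset_Icc_left (hac.le.trans hcd.lt.le))

theorem HasBands.tr_succ (hlam : 4 < lam) {N : ℕ}
    (h : HasBands (tr lam (n + 2)) (bandSet lam n) N) :
    HasBands (tr lam (n + 3)) (bandSet lam (n + 2)) N := by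
  have hnext := h.refine (M := 1) fun a b hband hsub => by
    obtain ⟨c, d, hcd, hband'⟩ := exists_isBand_tr_succ hlam hband hsub
    exact hband'.hasBands (hcd.trans Ioo_subset_Icc_self)
  rw [mul_one] at hnext
  exact hnext.mono inter_subset_right

theorem HasBands.tr_add_two (hlam : 4 < lam) {N : ℕ}
    (h : HasBands (tr lam (n + 1)) (bandSet lam n) N) :
    HasBands (tr lam (n + 3)) (bandSet lam n ∩ bandSet lam (n + 1)) N := by
  have hskip := h.refine (M := 1) fun a b hband hsub => by
    obtain ⟨c, d, hcd, hband'⟩ := exists_isBand_tr_add_two hlam hband hsub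
    exact hband'.hasBands (hcd.trans Ioo_subset_Icc_self)
  rwa [mul_one] at hskip

theorem HasBands.two_mul_tr_add_two (hlam : 4 < lam) {N : ℕ}
    (h : HasBands (tr lam (n + 2)) (bandSet lam n) N) :
    HasBands (tr lam (n + 4)) (bandSet lam n ∩ bandSet lam (n + 2)) (N * 2) :=
  h.refine fun _ _ => hasBands_two_tr_add_two hlam

theorem isBand_tr_one : IsBand (tr lam 1) (-2) 2 := by
  refine ⟨by norm_num, fun E hE => ?_, Or.inl ?_⟩
  · rw [tr_one, abs_le]
    exact hE
  · simp [tr_one]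

theorem isBand_tr_two : IsBand (tr lam 2) (lam - 2) (lam + 2) := by
  refine ⟨by linarith, fun E hE => ?_, Or.inl ?_⟩
  · rw [tr_two, abs_le]
    constructor <;> linarith [hE.1, hE.2]
  · simp [tr_two]

theorem hasBands_tr (hlam : 4 < lam) : ∀ n,
    HasBands (tr lam (n + 2)) (bandSet lam (n + 1)) (Nat.fib n) ∧
      HasBands (tr lam (n + 2)) (bandSet lam n) (Nat.fib (n + 1))
  | 0 => by
    refine ⟨⟨∅, ⟨by simp, by simp, by simp⟩, rfl⟩, isBand_tr_two.hasBands ?_⟩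
    simp only [bandSet_zero, subset_univ]
  | 1 => by
    have hone : HasBands (tr lam 1) (bandSet lam 0) 1 :=
      isBand_tr_one.hasBands (by simp only [bandSet_zero, subset_univ])
    exact ⟨(hasBands_tr hlam 0).2.tr_succ hlam, (hone.tr_add_two hlam).mono inter_subset_right⟩
  | n + 2 => by
    obtain ⟨hskip, htwo⟩ := hasBands_tr hlam n
    refine ⟨(hasBands_tr hlam (n + 1)).2.tr_succ hlam, ?_⟩
    have hunion := (hskip.tr_add_two hlam).union (htwo.two_mul_tr_add_two hlam)
      ((disjoint_bandSet_inter hlam n).mono_right inter_subset_left)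
    have hfib : Nat.fib (n + 2 + 1) = Nat.fib n + Nat.fib (n + 1) * 2 := by
      rw [Nat.fib_add_two (n := n + 1), Nat.fib_add_two (n := n)]
      ring
    rw [hfib]
    exact hunion.mono (union_subset inter_subset_right inter_subset_right)

theorem hasBands_tr_univ (hlam : 4 < lam) (n : ℕ) :
    HasBands (tr lam (n + 2)) univ (Nat.fib (n + 2)) := by
  obtain ⟨hskip, hnext⟩ := hasBands_tr hlam n
  rw [Nat.fib_add_two]
  exact (hskip.inter_setOf_abs_le_two.union hnext.inter_setOf_abs_le_two
    ((disjoint_bandSet_inter hlam n).mono_right inter_subset_left)).mono (subset_univ _)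

end Nested

/-! ### Diophantine properties of the golden mean -/

theorem ω_eq_neg_goldenConj : ω = -Real.goldenConj := by
  simp only [ω, Real.goldenConj]; ring

theorem inv_ω : ω⁻¹ = Real.goldenRatio := by
  rw [ω_eq_neg_goldenConj, inv_neg, Real.inv_goldenConj, neg_neg]

theorem goldenRatio_pow_le_fib (n : ℕ) : Real.goldenRatio ^ n ≤ Nat.fib (n + 2) := by
  rw [← Real.fib_succ_sub_goldenConj_mul_fib, Nat.fib_add_two, Nat.cast_add]
  nlinarith [Real.neg_one_lt_goldenConj, (Nat.fib n).cast_nonneg (α := ℝ)]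

theorem irrational_ω : Irrational ω :=
  ω_eq_neg_goldenConj ▸ Real.goldenConj_irrational.neg

theorem ω_sq : ω ^ 2 = 1 - ω := by
  rw [ω_eq_neg_goldenConj, neg_sq, Real.goldenConj_sq]; ring

theorem ω_pos : 0 < ω := by
  linarith [ω_eq_neg_goldenConj, Real.goldenConj_neg]

theorem ω_lt_one : ω < 1 := by
  linarith [ω_eq_neg_goldenConj, Real.neg_one_lt_goldenConj]

theorem half_lt_ω : 1 / 2 < ω := by nlinarith [ω_sq, ω_pos]

theorem fib_succ_mul_ω_sub_fib (k : ℕ) :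
    (Nat.fib (k + 1) : ℝ) * ω - Nat.fib k = -(-ω) ^ (k + 1) := by
  rw [ω_eq_neg_goldenConj, neg_neg, ← Real.goldenConj_mul_fib_succ_add_fib]; ring

theorem ω_pow_le_abs_mul_ω_sub : ∀ (k : ℕ) {n : ℕ} {m : ℤ}, n < Nat.fib (k + 2) →
    (n : ℝ) * ω ≠ m → ω ^ (k + 1) ≤ |(n : ℝ) * ω - m|
  | 0, n, m, hn, hne => by
    obtain rfl : n = 0 := by simpa using hn
    have hm : 1 ≤ |m| := Int.one_le_abs fun h => hne (by simp [h])
    have hm' : (1 : ℝ) ≤ |(m : ℝ)| := mod_cast hm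
    simpa using ω_lt_one.le.trans hm'
  | 1, n, m, hn, hne => by
    obtain hn0 | rfl : n < Nat.fib 2 ∨ n = 1 := by
      rw [Nat.fib_two]
      exact Nat.lt_or_eq_of_le (Nat.lt_succ_iff.1 hn)
    · have hle := ω_pow_le_abs_mul_ω_sub 0 hn0 hne
      exact (pow_le_pow_of_le_one ω_pos.le ω_lt_one.le (by lia)).trans hle
    · rw [Nat.cast_one, one_mul, ω_sq, le_abs]
      rcases le_or_gt m 0 with hm | hm
      · have hm' : (m : ℝ) ≤ 0 := mod_cast hm
        exact Or.inl (by linarith [half_lt_ω])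
      · have hm' : (1 : ℝ) ≤ m := mod_cast hm
        exact Or.inr (by linarith)
  | k + 2, n, m, hn, hne => by
    have hanti : ω ^ (k + 3) ≤ ω ^ (k + 2) :=
      pow_le_pow_of_le_one ω_pos.le ω_lt_one.le (by lia)
    rcases lt_or_ge n (Nat.fib (k + 3)) with hlt | hge
    · exact hanti.trans (ω_pow_le_abs_mul_ω_sub (k + 1) hlt hne)
    obtain ⟨n', rfl⟩ := Nat.exists_eq_add_of_le hge
    have hsplit : ((Nat.fib (k + 3) + n' : ℕ) : ℝ) * ω - m =
        ((n' : ℝ) * ω - (m - Nat.fib (k + 2) : ℤ)) + -(-ω) ^ (k + 3) := by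
      push_cast
      linear_combination fib_succ_mul_ω_sub_fib (k + 2)
    have habs : |(-ω) ^ (k + 3)| = ω ^ (k + 3) := by rw [abs_pow, abs_neg, abs_of_pos ω_pos]
    rw [hsplit]
    by_cases heq : (n' : ℝ) * ω = (m - Nat.fib (k + 2) : ℤ)
    · rw [heq, sub_self, zero_add, abs_neg, habs]
    · have hn' : n' < Nat.fib (k + 2) := by
        have hfib : Nat.fib (k + 2 + 2) = Nat.fib (k + 2) + Nat.fib (k + 3) := Nat.fib_add_two
        lia
      have hle := ω_pow_le_abs_mul_ω_sub k hn' heq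
      have htri := abs_sub_abs_le_abs_add ((n' : ℝ) * ω - (m - Nat.fib (k + 2) : ℤ))
        (-(-ω) ^ (k + 3))
      rw [abs_neg, habs] at htri
      have hpow : ω ^ (k + 1) - ω ^ (k + 3) = ω ^ (k + 2) := by
        linear_combination -ω ^ (k + 1) * ω_sq
      linarith

theorem floor_add_eq_floor {y δ : ℝ} (hle : ∀ m : ℤ, |δ| ≤ |y - m|) (hne : ∀ m : ℤ, y + δ ≠ m) :
    ⌊y + δ⌋ = ⌊y⌋ := by
  have h0 := Int.floor_le y
  have h1 := Int.lt_floor_add_one y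
  have hfloor := hle ⌊y⌋
  have hceil := hle (⌊y⌋ + 1)
  have hne' := hne (⌊y⌋ + 1)
  push_cast at hceil hne'
  rw [abs_of_nonneg (sub_nonneg.2 h0)] at hfloor
  rw [abs_of_neg (sub_neg.2 h1)] at hceil
  refine Int.floor_eq_iff.2 ⟨by linarith [neg_abs_le δ], lt_of_le_of_ne ?_ hne'⟩
  linarith [le_abs_self δ]

theorem floor_add_fib_mul_ω (k : ℕ) {n : ℕ} (hn : 0 < n) (hn' : n < Nat.fib (k + 2)) :
    ⌊((n : ℝ) + Nat.fib (k + 1)) * ω⌋ = ⌊(n : ℝ) * ω⌋ + Nat.fib k := by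
  have hirr {j : ℕ} (hj : 0 < j) (m : ℤ) : (j : ℝ) * ω ≠ m :=
    (irrational_ω.natCast_mul hj.ne').ne_int m
  have hsplit : ((n : ℝ) + Nat.fib (k + 1)) * ω = n * ω + -(-ω) ^ (k + 1) + Nat.fib k := by
    linear_combination fib_succ_mul_ω_sub_fib k
  rw [hsplit, Int.floor_add_natCast, floor_add_eq_floor (fun m => ?_) fun m hm => ?_]
  · rw [abs_neg, abs_pow, abs_neg, abs_of_pos ω_pos]
    exact ω_pow_le_abs_mul_ω_sub k hn' (hirr hn m)
  · refine hirr (Nat.add_pos_left hn (Nat.fib (k + 1))) (m + Nat.fib k) ?_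
    push_cast
    rw [hsplit, hm]

theorem indicator_Ico_fract {α : ℝ} (hα₀ : 0 ≤ α) (hα₁ : α ≤ 1) (y : ℝ) :
    indicator (Ico (1 - α) 1) (fun _ => (1 : ℝ)) (Int.fract y) = ⌊y + α⌋ - ⌊y⌋ := by
  have hy := Int.floor_add_fract y
  have h0 := Int.fract_nonneg y
  have h1 := Int.fract_lt_one y
  by_cases h : 1 - α ≤ Int.fract y
  · have hfloor : ⌊y + α⌋ = ⌊y⌋ + 1 := by
      rw [Int.floor_eq_iff]; push_cast; constructor <;> linarith
    rw [indicator_of_mem (mem_Ico.2 ⟨h, h1⟩), hfloor]; push_cast; ring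
  · have hfloor : ⌊y + α⌋ = ⌊y⌋ := by
      rw [Int.floor_eq_iff]; constructor <;> linarith
    rw [indicator_of_notMem (fun hmem => h hmem.1), hfloor, sub_self]

/-! ### Transfer matrices -/

theorem V_eq_mul_floor_sub_floor (lam : ℝ) (n : ℤ) :
    V lam n = lam * (⌊((n : ℝ) + 1) * ω⌋ - ⌊(n : ℝ) * ω⌋) := by
  rw [V, indicator_Ico_fract ω_pos.le ω_lt_one.le, add_one_mul]

theorem V_add_fib (lam : ℝ) (k : ℕ) {n : ℕ} (hn : 0 < n) (hn' : n + 1 < Nat.fib (k + 2)) :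
    V lam (n + Nat.fib (k + 1)) = V lam n := by
  have h0 := floor_add_fib_mul_ω k hn (by lia)
  have h1 := floor_add_fib_mul_ω k (Nat.succ_pos n) hn'
  rw [Nat.cast_succ, add_right_comm] at h1
  simp only [V_eq_mul_floor_sub_floor, Int.cast_add, Int.cast_natCast, h0, h1]
  ring

theorem V_one (lam : ℝ) : V lam 1 = lam := by
  have h1 : ⌊ω⌋ = 0 := Int.floor_eq_zero_iff.2 ⟨ω_pos.le, ω_lt_one⟩
  have h2 : ⌊(1 + 1) * ω⌋ = 1 := by
    rw [Int.floor_eq_iff]; push_cast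
    constructor <;> linarith [half_lt_ω, ω_lt_one]
  simp [V_eq_mul_floor_sub_floor, h1, h2]

theorem V_two (lam : ℝ) : V lam 2 = 0 := by
  have h2 : ⌊2 * ω⌋ = 1 := by
    rw [Int.floor_eq_iff]; push_cast
    constructor <;> linarith [half_lt_ω, ω_lt_one]
  have h3 : ⌊(2 + 1) * ω⌋ = 1 := by
    rw [Int.floor_eq_iff]; push_cast
    constructor <;> nlinarith [half_lt_ω, ω_sq]
  simp [V_eq_mul_floor_sub_floor, h2, h3]

theorem stepProd_add (lam E : ℝ) (m : ℤ) (i j : ℕ) :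
    stepProd lam E m (i + j) = stepProd lam E (m + i) j * stepProd lam E m i := by
  induction j with
  | zero => simp [stepProd]
  | succ j ih =>
    rw [← add_assoc, stepProd, stepProd, ih, ← mul_assoc]
    push_cast
    simp only [add_assoc]

theorem stepProd_congr (lam E : ℝ) {m m' : ℤ} {j : ℕ}
    (h : ∀ i : ℕ, i < j → V lam (m + (i + 1 : ℕ)) = V lam (m' + (i + 1 : ℕ))) :
    stepProd lam E m j = stepProd lam E m' j := by
  induction j with
  | zero => rfl
  | succ j ih =>
    rw [stepProd, stepProd, ih fun i hi => h i (hi.trans j.lt_succ_self), A, A, h j j.lt_succ_self]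

theorem det_stepProd (lam E : ℝ) (m : ℤ) (j : ℕ) : (stepProd lam E m j).det = 1 := by
  induction j with
  | zero => simp [stepProd]
  | succ j ih => rw [stepProd, Matrix.det_mul, ih, A, Matrix.det_fin_two_of]; ring

theorem M_eq_stepProd (lam : ℝ) (k : ℕ) (E : ℝ) :
    M lam k E = stepProd lam E 0 (Nat.fib (k + 1)) := by
  rw [M, T, if_pos (by positivity), sub_zero, Int.toNat_natCast, F]

theorem det_M (lam : ℝ) (k : ℕ) (E : ℝ) : (M lam k E).det = 1 := by
  rw [M_eq_stepProd, det_stepProd]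

theorem M_one (lam E : ℝ) : M lam 1 E = !![E - lam, -1; 1, 0] := by
  rw [M_eq_stepProd]
  simp [stepProd, A, V_one]

theorem M_two (lam E : ℝ) : M lam 2 E = !![E, -1; 1, 0] * M lam 1 E := by
  have hfib : Nat.fib (2 + 1) = 2 := rfl
  rw [M_one, M_eq_stepProd, hfib]
  simp [stepProd, A, V_one, V_two]

theorem M_rec (lam : ℝ) (k : ℕ) (E : ℝ) :
    M lam (k + 3) E = M lam (k + 1) E * M lam (k + 2) E := by
  have hfib : Nat.fib (k + 3 + 1) = Nat.fib (k + 2 + 1) + Nat.fib (k + 1 + 1) := by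
    rw [Nat.fib_add_two, add_comm]
  rw [M_eq_stepProd, M_eq_stepProd, M_eq_stepProd, hfib, stepProd_add]
  congr 1
  refine stepProd_congr lam E fun i hi => ?_
  rw [zero_add, zero_add, add_comm]
  refine V_add_fib lam (k + 2) i.succ_pos ?_
  have hlt : Nat.fib (k + 2) < Nat.fib (k + 3) := Nat.fib_lt_fib_succ (by lia)
  have hpos : 0 < Nat.fib (k + 2) := Nat.fib_pos.2 (by lia)
  rw [Nat.fib_add_two (n := k + 2)]
  lia

theorem trace_mul_mul_self {R : Type*} [CommRing R] (P Q : Matrix (Fin 2) (Fin 2) R) :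
    (P * (Q * P)).trace = (Q * P).trace * P.trace - P.det * Q.trace := by
  simp only [Matrix.det_fin_two, Matrix.trace_fin_two, Matrix.mul_apply, Fin.sum_univ_two]
  ring

theorem x_one (lam E : ℝ) : x lam 1 E = E - lam := by
  simp [x, M_one, Matrix.trace_fin_two]

theorem x_two (lam E : ℝ) : x lam 2 E = (E - lam) * E - 2 := by
  rw [x, M_two, M_one, Matrix.mul_fin_two, Matrix.trace_fin_two_of]; ring

theorem x_three (lam E : ℝ) : x lam 3 E = x lam 2 E * x lam 1 E - E := by
  simp only [x]
  rw [M_rec lam 0, M_two, trace_mul_mul_self, det_M, Matrix.trace_fin_two_of]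
  ring

theorem x_rec (lam : ℝ) (k : ℕ) (E : ℝ) :
    x lam (k + 4) E = x lam (k + 3) E * x lam (k + 2) E - x lam (k + 1) E := by
  simp only [x]
  rw [M_rec lam (k + 1), M_rec lam k, trace_mul_mul_self, det_M, one_mul]

theorem x_succ (lam E : ℝ) : ∀ n, x lam (n + 1) E = tr lam (n + 2) E
  | 0 => by rw [x_one, tr_two]
  | 1 => by rw [x_two, tr_rec, tr_two, tr_one, tr_zero]
  | 2 => by rw [x_three, tr_rec lam 1, x_succ lam E 1, x_one, tr_two, tr_one]
  | n + 3 => by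
    rw [x_rec, tr_rec lam (n + 2), x_succ lam E (n + 2), x_succ lam E (n + 1), x_succ lam E n]

/-! ### Lengths of the bands and measure of the spectrum -/

-- `F 0 = F 1`, hence `x lam 0 = x lam 1`, which the truncated subtraction reflects.
theorem x_eq_tr (lam : ℝ) : ∀ k, x lam k = tr lam (k - 1 + 2)
  | 0 => funext fun E => x_succ lam E 0
  | n + 1 => funext fun E => x_succ lam E n

theorem F_eq_fib : ∀ k, F k = Nat.fib (k - 1 + 2)
  | 0 => rfl
  | _ + 1 => rfl

theorem exists_isBand_x {lam : ℝ} (hlam : 4 < lam) (k : ℕ) :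
    ∃ a b : Fin (F k) → ℝ, σ lam k = ⋃ i, Icc (a i) (b i) ∧
      Pairwise (Function.onFun Disjoint fun i => Icc (a i) (b i)) ∧
      ∀ i, IsBand (x lam k) (a i) (b i) := by
  obtain ⟨S, hS, hcard⟩ := hasBands_tr_univ hlam (k - 1)
  have hdeg : (tracePoly lam (k - 1 + 2)).natDegree = Nat.fib (k - 1 + 2) :=
    (isMonicOfDegree_tracePoly lam (k - 1 + 1)).natDegree_eq
  let e : Fin (F k) ≃ S := (S.equivFinOfCardEq (hcard.trans (F_eq_fib k).symm)).symm
  refine ⟨fun i => (e i).1.1, fun i => (e i).1.2, ?_, fun i j hij => ?_, fun i => ?_⟩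
  · have hσ : σ lam k = ⋃ q ∈ S, Icc q.1 q.2 := by
      rw [σ, x_eq_tr]
      exact hS.setOf_abs_eval_le_two_eq (hcard.trans hdeg.symm)
        (hdeg ▸ Nat.fib_pos.2 (Nat.succ_pos _))
    rw [hσ, e.surjective.iUnion_comp fun q : S => Icc q.1.1 q.1.2, iUnion_subtype]
  · exact hS.pairwiseDisjoint (e i).2 (e j).2 fun h => hij (e.injective (Subtype.ext h))
  · exact x_eq_tr lam k ▸ hS.isBand _ (e i).2

theorem IsBand.four_div_le_length {lam : ℝ} (hlam : 4 < lam) {k : ℕ} {a b : ℝ}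
    (h : IsBand (x lam k) a b) : 4 / (2 * lam + 22) ^ (k - 1) ≤ b - a := by
  rw [x_eq_tr] at h
  rw [div_le_iff₀' (pow_pos (by linarith) _)]
  exact h.four_le_mul_length (fun E _ => differentiable_tr lam _ E)
    fun E hE => abs_deriv_tr_le hlam E _ (h.abs_le_two E hE)

theorem pow_le_rpow_logb {q s y : ℝ} (hq : 1 < q) (hs : 1 ≤ s) {n : ℕ} (h : q ^ n ≤ y) :
    s ^ n ≤ y ^ Real.logb q s := calc
  s ^ n = (q ^ n) ^ Real.logb q s := by
    rw [← Real.rpow_pow_comm (by linarith), Real.rpow_logb (by linarith) hq.ne' (by linarith)]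
  _ ≤ y ^ Real.logb q s := by
    gcongr
    exact Real.logb_nonneg hq hs

theorem F_rpow_neg_γ_le {lam : ℝ} (hlam : 4 < lam) (k : ℕ) :
    (F k : ℝ) ^ (-γ lam) ≤ F k / (2 * lam + 22) ^ (k - 1) := by
  have hF : (0 : ℝ) < F k := mod_cast Nat.fib_pos.2 k.succ_pos
  have hγ : -γ lam = 1 - Real.logb ω⁻¹ (2 * lam + 22) := by
    rw [γ, Real.log_div_log, neg_sub]
  have hpow : ω⁻¹ ^ (k - 1) ≤ F k := by
    rw [inv_ω, F_eq_fib]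
    exact goldenRatio_pow_le_fib (k - 1)
  rw [hγ, Real.rpow_sub hF, Real.rpow_one]
  gcongr
  exact pow_le_rpow_logb ((one_lt_inv₀ ω_pos).2 ω_lt_one) (by linarith) hpow

theorem card_mul_le_measure_iUnion {ι α : Type*} [Fintype ι] [MeasurableSpace α] {μ : Measure α}
    {s : ι → Set α} (hd : Pairwise (Function.onFun Disjoint s)) (hs : ∀ i, MeasurableSet (s i))
    {c : ENNReal} (hc : ∀ i, c ≤ μ (s i)) : Fintype.card ι * c ≤ μ (⋃ i, s i) := by
  rw [measure_iUnion hd hs, tsum_fintype, ← nsmul_eq_mul]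
  exact Finset.card_nsmul_le_sum _ _ _ fun i _ => hc i

theorem IsBand.ofReal_le_volume_Icc {lam : ℝ} (hlam : 4 < lam) {k : ℕ} {a b : ℝ}
    (h : IsBand (x lam k) a b) :
    ENNReal.ofReal (4 / (2 * lam + 22) ^ (k - 1)) ≤ volume (Icc a b) := by
  rw [Real.volume_Icc]
  exact ENNReal.ofReal_le_ofReal (h.four_div_le_length hlam)

theorem ofReal_mul_F_rpow_le_volume_σ {lam : ℝ} (hlam : 4 < lam) (k : ℕ) :
    ENNReal.ofReal (4 * (F k : ℝ) ^ (-γ lam)) ≤ volume (σ lam k) := by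
  obtain ⟨a, b, hσ, hdisj, hband⟩ := exists_isBand_x hlam k
  calc ENNReal.ofReal (4 * (F k : ℝ) ^ (-γ lam))
      ≤ ENNReal.ofReal (F k * (4 / (2 * lam + 22) ^ (k - 1))) := by
        refine ENNReal.ofReal_le_ofReal ?_
        rw [mul_div_left_comm]
        exact mul_le_mul_of_nonneg_left (F_rpow_neg_γ_le hlam k) zero_le_four
    _ = Fintype.card (Fin (F k)) * ENNReal.ofReal (4 / (2 * lam + 22) ^ (k - 1)) := by
        rw [ENNReal.ofReal_mul (Nat.cast_nonneg _), ENNReal.ofReal_natCast, Fintype.card_fin]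
    _ ≤ volume (σ lam k) := by
        rw [hσ]
        exact card_mul_le_measure_iUnion hdisj (fun _ => measurableSet_Icc)
          fun i => (hband i).ofReal_le_volume_Icc hlam

end FibHam

end

theorem proposition2 :
    ∃ C : ℝ, 0 < C ∧ ∀ lam : ℝ, 4 < lam → ∀ k : ℕ,
      (∃ a b : Fin (FibHam.F k) → ℝ,
        FibHam.σ lam k = ⋃ i, Set.Icc (a i) (b i) ∧
        (∀ i j, i ≠ j → Disjoint (Set.Icc (a i) (b i)) (Set.Icc (a j) (b j))) ∧
        (∀ i, a i ≤ b i) ∧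
        (∀ i, ENNReal.ofReal (4 / (C * (2 * lam + 22) ^ k)) ≤ volume (Set.Icc (a i) (b i)))) ∧
      ENNReal.ofReal (4 / C * (FibHam.F k : ℝ) ^ (-FibHam.γ lam)) ≤ volume (FibHam.σ lam k) := by
  refine ⟨1, one_pos, fun lam hlam k => ?_⟩
  obtain ⟨a, b, hσ, hdisj, hband⟩ := FibHam.exists_isBand_x hlam k
  rw [one_mul, div_one]
  refine ⟨⟨a, b, hσ, fun _ _ hij => hdisj hij, fun i => (hband i).lt.le, fun i => ?_⟩,
    FibHam.ofReal_mul_F_rpow_le_volume_σ hlam k⟩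
  refine le_trans ?_ ((hband i).ofReal_le_volume_Icc hlam)
  gcongr
  exacts [by linarith, k.sub_le 1]
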